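/- Let $V$ be a finite dimensional real vector space, $\mathcal D(V)$ the space of (real or complex valued) distributions on $V$, and $X=[a_1,\dots,a_m]$ a finite list of nonzero vectors of $V$. A subspace $r\subseteq V$ is called *rational* if it is spanned by a (possibly empty) sublist of $X$; let $S_X$ be the set of rational subspaces. Write $X\cap r$ and $X\setminus r$ for the sublists of the vectors of $X$ lying, resp. not lying, in $r$, and $\partial_Y=\prod_{a\in Y}\partial_a$ for a list $Y$, where $\partial_a$ is the directional derivative. Let $\mathcal D(V,r)\subseteq\mathcal D(V)$ be the space of distributions which vanish on every test function that vanishes on $r$ (these are identified with the distributions on $r$), and put $$G(X)=\{f\in\mathcal D(V)\mid \partial_{X\setminus r}f\in\mathcal D(V,r)\ \text{ for all } r\in S_X\}.$$ For $r\in S_X$ let $D(X\cap r)\subseteq\mathcal D(V,r)$ be the space of those $g\in\mathcal D(V,r)$ with $\partial_Yg=0$ for every cocircuit $Y$ of $X\cap r$, i.e. every sublist $Y$ of $X\cap r$ that is minimal with the property that $(X\cap r)\setminus Y$ does not span $r$ (the Dahmen--Micchelli space of $X\cap r$). For every $r\in S_X$ choose a regular face $F_r$ for $X\setminus r$, i.e.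 an open face, in the annihilator $r^\perp\subseteq V^*$, of the arrangement of the hyperplanes $\{u\in r^\perp\mid\langle u,a\rangle=0\}$, $a\in X\setminus r$. Let $A$, $B$ be the sublists of $X\setminus r$ of the vectors on which $F_r$ is positive, resp. negative, let $c_1,\dots,c_k$ be the list $[A,-B]$, and let $T^{F_r}_{X\setminus r}\in\mathcal D(V)$ be the distribution $$\langle T^{F_r}_{X\setminus r}\mid\varphi\rangle=(-1)^{|B|}\int_0^\infty\!\!\cdots\int_0^\infty \varphi\Bigl(\sum_{j=1}^k t_jc_j\Bigr)\,dt_1\cdots dt_k .$$ Then for every $r\in S_X$ and every $g\in\mathcal D(V,r)$ the convolution $T^{F_r}_{X\setminus r}*g\in\mathcal D(V)$, $\langle T^{F_r}_{X\setminus r}*g\mid\varphi\rangle=\langle g(x)\mid\langle T^{F_r}_{X\setminus r}(y)\mid\varphi(x+y)\rangle\rangle$, is well defined (on a neighbourhood of $r$ the function of $x$ in this formula agrees with a test function), and $$G(X)=\bigoplus_{r\in S_X}T^{F_r}_{X\setminus r}*D(X\cap r),$$ where $T^{F_r}_{X\setminus r}*D(X\cap r)=\{T^{F_r}_{X\setminus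 r}*g\mid g\in D(X\cap r)\}$. -/

import Mathlib

open Distribution TopologicalSpace MeasureTheory Filter Topology
open scoped Distributions LineDeriv

noncomputable section

namespace SplineDecomposition

/-! Throughout, a distribution on the finite dimensional real vector space `V` is an element of
`𝓓'((⊤ : Opens V), 𝕜)`, where `𝕜` is `ℝ` or `ℂ`. A list of vectors is a finite family `X : ι → V`
(repetitions are allowed), and a sublist is a finite set of indices. -/

section Lists

variable {V : Type*} [NormedAddCommGroup V] [NormedSpace ℝ V] {ι : Type*} [Fintype ι]

open Classical in
/-- The sublist `X ∩ r` of the vectors of `X` which lie in `r`. -/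
def inside (X : ι → V) (r : Submodule ℝ V) : Finset ι :=
  Finset.univ.filter fun i => X i ∈ r

open Classical in
/-- The sublist `X ∖ r` of the vectors of `X` which do not lie in `r`. -/
def outside (X : ι → V) (r : Submodule ℝ V) : Finset ι :=
  Finset.univ.filter fun i => X i ∉ r

/-- A subspace is rational relative to `X` if it is spanned by a (possibly empty) sublist of
`X`. -/
def IsRational (X : ι → V) (r : Submodule ℝ V) : Prop :=
  ∃ S : Finset ι, Submodule.span ℝ (X '' (S : Set ι)) = r

/-- `Y` is a cocircuit of the list `Z`: a sublist of `Z` whose removal from `Z` leaves a list which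
does not span the span of `Z`, and which is minimal with this property. -/
def IsCocircuit (X : ι → V) (Z Y : Finset ι) : Prop :=
  Minimal (fun Y : Finset ι => Y ⊆ Z ∧
    Submodule.span ℝ (X '' ((Z : Set ι) \ (Y : Set ι))) ≠
      Submodule.span ℝ (X '' (Z : Set ι))) Y

/-- `F` is a regular face for `X ∖ r`: an open face of the arrangement of the hyperplanes
`{u | u (X i) = 0}`, `X i ∉ r`, in the annihilator of `r` in the dual space, that is, the set of all
vectors of the annihilator on which these linear forms have the same (nonzero) signs as on one
regular vector `u`. -/
def IsRegularFace (X : ι → V) (r : Submodule ℝ V) (F : Set (Module.Dual ℝ V)) : Prop :=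
  ∃ u ∈ r.dualAnnihilator, (∀ i ∈ outside X r, u (X i) ≠ 0) ∧
    F = {v | v ∈ r.dualAnnihilator ∧ ∀ i ∈ outside X r, 0 < u (X i) * v (X i)}

open Classical in
/-- The part `B` of `X ∖ r` of the vectors on which the face `F` is negative. -/
def negativePart (X : ι → V) (r : Submodule ℝ V) (F : Set (Module.Dual ℝ V)) : Finset ι :=
  (outside X r).filter fun i => ∀ u ∈ F, u (X i) < 0

end Lists

section Derivatives

variable {V : Type*} [NormedAddCommGroup V] [NormedSpace ℝ V]
variable (𝕜 : Type*) [RCLike 𝕜]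

/-- The directional derivative `∂_a` of distributions, as a `𝕜`-linear operator. -/
def dirDeriv (a : V) : Module.End 𝕜 𝓓'((⊤ : Opens V), 𝕜) where
  toFun f := ∂_{a} f
  map_add' f g := LineDeriv.lineDerivOp_add a f g
  map_smul' c f := by
    ext φ
    change (∂_{a} (c • f)) φ = c • (∂_{a} f) φ
    rw [Distribution.lineDerivOp_apply_apply, Distribution.lineDerivOp_apply_apply]
    rfl

@[simp]
theorem dirDeriv_apply_apply (a : V) (f : 𝓓'((⊤ : Opens V), 𝕜)) (φ : 𝓓((⊤ : Opens V), ℝ)) :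
    dirDeriv 𝕜 a f φ = -f (∂_{a} φ) := by
  change (∂_{a} f) φ = _
  rw [Distribution.lineDerivOp_apply_apply, map_neg]

theorem lineDerivOp_comm (a b : V) (φ : 𝓓((⊤ : Opens V), ℝ)) :
    ∂_{a} (∂_{b} φ) = ∂_{b} (∂_{a} φ) := by
  have key : ∀ (a b x : V), (∂_{a} (∂_{b} φ)) x = fderiv ℝ (fderiv ℝ φ) x a b := by
    intro a b x
    have h2 : ∀ c : V, ((∂_{c} φ : 𝓓((⊤ : Opens V), ℝ)) : V → ℝ) = fun y => fderiv ℝ φ y c := by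
      intro c
      funext y
      rw [TestFunction.lineDerivOp_eq_lineDerivCLM ℝ, TestFunction.lineDerivCLM_eq_fderivCLM,
        TestFunction.fderivCLM_apply_of_le _ (by simp)]
    have h1 : (∂_{a} (∂_{b} φ) : 𝓓((⊤ : Opens V), ℝ)) x
        = fderiv ℝ (∂_{b} φ : 𝓓((⊤ : Opens V), ℝ)) x a := by
      rw [TestFunction.lineDerivOp_eq_lineDerivCLM ℝ (v := a),
        TestFunction.lineDerivCLM_eq_fderivCLM, TestFunction.fderivCLM_apply_of_le _ (by simp)]
    have h3 : DifferentiableAt ℝ (fderiv ℝ φ) x :=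
      ((φ.contDiff.fderiv_right (m := 1) (by norm_cast)).differentiable (by simp)) x
    rw [h1, h2, fderiv_clm_apply h3 (differentiableAt_const b)]
    simp
  ext x
  rw [key, key]
  have : IsSymmSndFDerivAt ℝ φ x :=
    (φ.contDiff.contDiffAt (x := x)).isSymmSndFDerivAt (by
      simp only [minSmoothness_of_isRCLikeNormedField]; norm_cast)
  exact this a b

theorem dirDeriv_commute (a b : V) : Commute (dirDeriv 𝕜 a) (dirDeriv 𝕜 b) := by
  ext f φ
  simp only [Module.End.mul_apply, dirDeriv_apply_apply]
  rw [lineDerivOp_comm a b φ]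

variable {ι : Type*} [Fintype ι]

/-- The operator `∂_Y = ∏_{a ∈ Y} ∂_a` attached to a sublist `Y` of `X`. -/
def diffOp (X : ι → V) (Y : Finset ι) : Module.End 𝕜 𝓓'((⊤ : Opens V), 𝕜) :=
  Y.noncommProd (fun i => dirDeriv 𝕜 (X i)) fun _ _ _ _ _ => dirDeriv_commute 𝕜 _ _

/-- The space `𝓓(V, r)` of the distributions which vanish on all test functions vanishing on
`r`. By duality with the restriction of test functions to `r`, it is identified with the space of
distributions on `r`. -/
def distributionsOn (r : Submodule ℝ V) : Submodule 𝕜 𝓓'((⊤ : Opens V), 𝕜) where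
  carrier := {f | ∀ φ : 𝓓((⊤ : Opens V), ℝ), (∀ x ∈ r, φ x = 0) → f φ = 0}
  zero_mem' _ _ := rfl
  add_mem' {f g} hf hg φ hφ := by
    change f φ + g φ = 0
    rw [hf φ hφ, hg φ hφ, add_zero]
  smul_mem' c f hf φ hφ := by
    change c • f φ = 0
    rw [hf φ hφ, smul_zero]

/-- The Dahmen--Micchelli space `D(Z)` of the list `Z`: the distributions on the span of `Z`
(regarded as distributions on `V`) which are killed by `∂_Y` for all cocircuits `Y` of `Z`. -/
def dahmenMicchelli (X : ι → V) (Z : Finset ι) : Submodule 𝕜 𝓓'((⊤ : Opens V), 𝕜) :=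
  distributionsOn 𝕜 (Submodule.span ℝ (X '' (Z : Set ι))) ⊓
    ⨅ (Y : Finset ι) (_ : IsCocircuit X Z Y), LinearMap.ker (diffOp 𝕜 X Y)

/-- The space `G(X)` of the distributions `f` such that `∂_{X ∖ r} f` lies in `𝓓(V, r)` for all
rational subspaces `r`. -/
def spaceG (X : ι → V) : Submodule 𝕜 𝓓'((⊤ : Opens V), 𝕜) :=
  ⨅ (r : Submodule ℝ V) (_ : IsRational X r),
    (distributionsOn 𝕜 r).comap (diffOp 𝕜 X (outside X r))

end Derivatives

section Splines

variable {V : Type*} [NormedAddCommGroup V] [NormedSpace ℝ V] [MeasurableSpace V] [BorelSpace V]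

/-- The image of Lebesgue measure on the orthant `[0, ∞)^κ` under `t ↦ ∑ t_k c_k`. -/
def orthantMeasure {κ : Type*} [Fintype κ] (c : κ → V) : Measure V :=
  (volume.restrict {t : κ → ℝ | ∀ k, 0 ≤ t k}).map fun t => ∑ k, t k • c k

/-- The multivariate spline `T_c`, that is `⟨T_c, φ⟩ = ∫_{[0,∞)^κ} φ(∑ t_k c_k) dt`, for a family
`c` of nonzero vectors spanning a pointed cone; see `multivariateSpline_apply`. -/
def multivariateSpline {κ : Type*} [Fintype κ] (c : κ → V) : 𝓓'((⊤ : Opens V), ℝ) :=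
  TestFunction.integralAgainstBilinCLM (ContinuousLinearMap.mul ℝ ℝ) (orthantMeasure c) fun _ => 1

theorem isFiniteMeasureOnCompacts_orthantMeasure [FiniteDimensional ℝ V] {κ : Type*} [Fintype κ]
    (c : κ → V) (hc : ∃ u : Module.Dual ℝ V, ∀ k, 0 < u (c k)) :
    IsFiniteMeasureOnCompacts (orthantMeasure c) := by
  obtain ⟨u, hu⟩ := hc
  refine ⟨fun K hK => ?_⟩
  have hcont : Continuous fun t : κ → ℝ => ∑ k, t k • c k := by fun_prop
  have hu_cont : Continuous u := u.continuous_of_finiteDimensional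
  obtain ⟨C, hC⟩ := (hK.image hu_cont).bddAbove
  rw [orthantMeasure, Measure.map_apply hcont.measurable hK.measurableSet,
    Measure.restrict_apply (hcont.measurable hK.measurableSet)]
  refine lt_of_le_of_lt (measure_mono ?_)
    (isCompact_Icc (a := (0 : κ → ℝ)) (b := fun k => C / u (c k))).measure_lt_top
  rintro t ⟨htK, ht⟩
  refine ⟨ht, fun k => ?_⟩
  have h1 : u (∑ k, t k • c k) ≤ C := hC ⟨_, htK, rfl⟩
  have h2 : t k * u (c k) ≤ u (∑ k, t k • c k) := by
    simp only [map_sum, map_smul, smul_eq_mul]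
    exact Finset.single_le_sum (f := fun k => t k * u (c k))
      (fun j _ => mul_nonneg (ht j) (hu j).le) (Finset.mem_univ k)
  change t k ≤ C / u (c k)
  rw [le_div_iff₀ (hu k)]
  exact h2.trans h1

theorem multivariateSpline_apply [FiniteDimensional ℝ V] {κ : Type*} [Fintype κ]
    (c : κ → V) (hc : ∃ u : Module.Dual ℝ V, ∀ k, 0 < u (c k)) (φ : 𝓓((⊤ : Opens V), ℝ)) :
    multivariateSpline c φ = ∫ t in {t : κ → ℝ | ∀ k, 0 ≤ t k}, φ (∑ k, t k • c k) := by
  have := isFiniteMeasureOnCompacts_orthantMeasure c hc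
  have hcont : Continuous fun t : κ → ℝ => ∑ k, t k • c k := by fun_prop
  have hloc : LocallyIntegrableOn (fun _ : V => (1 : ℝ)) ((⊤ : Opens V) : Set V)
      (orthantMeasure c) :=
    (continuous_const.locallyIntegrable).locallyIntegrableOn _
  have h := TestFunction.integralAgainstBilinCLM_eq_integral (B := ContinuousLinearMap.mul ℝ ℝ)
    hloc (f := φ)
  refine Eq.trans h ?_
  simp only [ContinuousLinearMap.mul_apply', mul_one]
  rw [orthantMeasure, integral_map hcont.aemeasurable φ.aestronglyMeasurable]

variable {ι : Type*} [Fintype ι]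

open Classical in
/-- The twisted spline `T_{X ∖ r}^F = (-1)^{|B|} T_{[A, -B]}`, where `A` and `B` are the sublists of
`X ∖ r` of the vectors on which the face `F` is positive, resp. negative. -/
def twistedSpline (X : ι → V) (r : Submodule ℝ V) (F : Set (Module.Dual ℝ V)) :
    𝓓'((⊤ : Opens V), ℝ) :=
  (-1 : ℝ) ^ (negativePart X r F).card •
    multivariateSpline fun i : outside X r =>
      if (i : ι) ∈ negativePart X r F then -X i else X i

end Splines

section Convolution

variable {V : Type*} [NormedAddCommGroup V] [NormedSpace ℝ V]

/-- The translated test function `y ↦ φ (x + y)`. -/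
def shift (φ : 𝓓((⊤ : Opens V), ℝ)) (x : V) : 𝓓((⊤ : Opens V), ℝ) where
  toFun y := φ (x + y)
  contDiff' := φ.contDiff.comp (contDiff_const.add contDiff_id)
  hasCompactSupport' := φ.hasCompactSupport.comp_homeomorph (Homeomorph.addLeft x)
  tsupport_subset' := fun _ _ => trivial

variable {𝕜 : Type*} [RCLike 𝕜]

/-- `U` is the convolution `T * g` of `T` with a distribution `g` supported in `C`:
`⟨T * g, φ⟩ = ⟨g(x), ⟨T(y), φ(x + y)⟩⟩`. The function `x ↦ ⟨T(y), φ(x + y)⟩` need not have compact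
support; it is replaced by any test function agreeing with it in a neighbourhood of `C`. -/
def IsConvolution (C : Set V) (T : 𝓓'((⊤ : Opens V), ℝ)) (g U : 𝓓'((⊤ : Opens V), 𝕜)) : Prop :=
  ∀ φ ψ : 𝓓((⊤ : Opens V), ℝ), (∀ᶠ x in 𝓝ˢ C, ψ x = T (shift φ x)) → U φ = g ψ

variable (𝕜) [MeasurableSpace V] [BorelSpace V] {ι : Type*} [Fintype ι]

/-- The space `T_{X ∖ r}^F * D(X ∩ r)`. -/
def component (X : ι → V) (r : Submodule ℝ V) (F : Set (Module.Dual ℝ V)) :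
    Submodule 𝕜 𝓓'((⊤ : Opens V), 𝕜) where
  carrier := {U | ∃ g ∈ dahmenMicchelli 𝕜 X (inside X r),
    IsConvolution (r : Set V) (twistedSpline X r F) g U}
  zero_mem' := ⟨0, zero_mem _, fun _ _ _ => rfl⟩
  add_mem' := by
    rintro U W ⟨g, hg, hU⟩ ⟨h, hh, hW⟩
    refine ⟨g + h, add_mem hg hh, fun φ ψ H => ?_⟩
    change U φ + W φ = g ψ + h ψ
    rw [hU φ ψ H, hW φ ψ H]
  smul_mem' := by
    rintro c U ⟨g, hg, hU⟩
    refine ⟨c • g, Submodule.smul_mem _ c hg, fun φ ψ H => ?_⟩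
    change c • U φ = c • g ψ
    rw [hU φ ψ H]

end Convolution

end SplineDecomposition

end

/-! Convolution with `T = T^{F_r}_{X∖r}` is a right inverse of `∂_{X∖r}` on distributions living on
`r`. By Fubini and the fundamental theorem of calculus on a half-line, `∂_a` with `a ∈ X∖r` removes
`a` from the spline (`IsConvolution.dirDeriv_erase`); other derivatives may be moved onto `g`
(`IsConvolution.dirDeriv`).

Hence the operators `∂_{X∖s}` act triangularly on the components. Let `U = T * g` with `g ∈ D(X∩r)`.
If `r ≰ s`, then `X∖s` contains a cocircuit of `X∩r`, so `∂_{X∖s} U = 0`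
(`IsConvolution.diffOp_outside_eq_zero`). If `r ≤ s`, only spline vectors in `s` survive and
`∂_{X∖s} U` lives on `s` (`IsConvolution.diffOp_outside_mem`). For `s = r` the result is `g`
(`IsConvolution.diffOp_outside_eq`). So the components lie in `G(X)`, and induction on dimension
makes them independent.

They span because a cocircuit `Y` of `X∩r` satisfies `Y ∪ (X∖r) = X∖t` with `t < r` rational. If `f
∈ G(X)` is killed by `∂_{X∖t}` for all rational `t` of dimension below `n`, then `∂_{X∖r} f ∈
D(X∩r)` for each `r` of dimension `n`; subtracting the corresponding convolutions raises `n` by one.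

The convolution exists because a form `u ∈ r^⊥` positive on the signed vectors makes the spline
transform of a test function compactly supported in the slab `|u| < 1`; a cutoff in `u` then yields
a continuous operator on test functions. -/

noncomputable section

namespace SplineDecomposition

/-! ### Smoothness of averages of translates -/

section TranslateAverage

open scoped ContDiff Pointwise

variable {V : Type*} [NormedAddCommGroup V] [NormedSpace ℝ V] [FiniteDimensional ℝ V]
  [MeasurableSpace V] [BorelSpace V] {E : Type*} [NormedAddCommGroup E] [NormedSpace ℝ E]

/-- The average `x ↦ ∫ f (x + y) dμ(y)` of the translates of `f`. -/
def translateAverage (μ : Measure V) (f : V → E) (x : V) : E := ∫ y, f (x + y) ∂μ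

omit [NormedSpace ℝ V] [FiniteDimensional ℝ V] [NormedSpace ℝ E] in
theorem integrable_comp_add_left {μ : Measure V} [IsFiniteMeasureOnCompacts μ] {f : V → E}
    (hf : Continuous f) (hc : HasCompactSupport f) (x : V) :
    Integrable (fun y => f (x + y)) μ :=
  (hf.comp (continuous_const.add continuous_id)).integrable_of_hasCompactSupport
    (hc.comp_homeomorph (Homeomorph.addLeft x))

theorem hasFDerivAt_translateAverage {μ : Measure V} [IsFiniteMeasureOnCompacts μ] {f : V → E}
    (hf : ContDiff ℝ 1 f) (hc : HasCompactSupport f) (x₀ : V) :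
    HasFDerivAt (translateAverage μ f) (translateAverage μ (fderiv ℝ f) x₀) x₀ := by
  have hf' : Continuous (fderiv ℝ f) := hf.continuous_fderiv one_ne_zero
  obtain ⟨C, hC⟩ := (hc.fderiv (𝕜 := ℝ)).exists_bound_of_continuous hf'
  -- For `x` within distance 1 of `x₀`, the derivative at `x + y` can be nonzero only for `y ∈ K`,
  -- so a constant on `K` dominates.
  let K : Set V := tsupport (fderiv ℝ f) - Metric.closedBall x₀ 1
  have hK : IsCompact K := by
    rw [show K = _ from sub_eq_add_neg _ _]
    exact (hc.fderiv (𝕜 := ℝ)).isCompact.add (isCompact_closedBall x₀ 1).neg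
  refine hasFDerivAt_integral_of_dominated_of_fderiv_le (F := fun x y => f (x + y))
    (F' := fun x y => fderiv ℝ f (x + y)) (bound := K.indicator fun _ => C)
    (Metric.closedBall_mem_nhds x₀ one_pos)
    (Eventually.of_forall fun x =>
      (integrable_comp_add_left hf.continuous hc x).aestronglyMeasurable)
    (integrable_comp_add_left hf.continuous hc x₀)
    (integrable_comp_add_left hf' (hc.fderiv (𝕜 := ℝ)) x₀).aestronglyMeasurable
    (Eventually.of_forall fun y x hx => ?_)
    ((integrable_indicator_iff hK.measurableSet).2 (integrableOn_const hK.measure_lt_top.ne))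
    (Eventually.of_forall fun y x _ => ?_)
  · by_cases hy : y ∈ K
    · rw [Set.indicator_of_mem hy]
      exact hC _
    · have h0 : x + y ∉ tsupport (fderiv ℝ f) := fun h =>
        hy ⟨x + y, h, x, hx, add_sub_cancel_left x y⟩
      rw [Set.indicator_of_notMem hy, image_eq_zero_of_notMem_tsupport h0, norm_zero]
  · exact (hasFDerivAt_comp_add_right y).2
      (hf.differentiable one_ne_zero (x + y)).hasFDerivAt

-- Only `y ∈ K - L` contribute. The factor `μ.real (K - L)` does not depend on `f`, which is what
-- the seminorm estimates need.
omit [NormedSpace ℝ V] [FiniteDimensional ℝ V] [BorelSpace V] in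
theorem norm_translateAverage_le {μ : Measure V} [IsFiniteMeasureOnCompacts μ] {f : V → E}
    {K L : Set V} (hK : IsCompact K) (hL : IsCompact L) (hf : ∀ z ∉ K, f z = 0) {C : ℝ}
    (hC : ∀ z, ‖f z‖ ≤ C) {x : V} (hx : x ∈ L) :
    ‖translateAverage μ f x‖ ≤ C * μ.real (K - L) := by
  have h : translateAverage μ f x = ∫ y in K - L, f (x + y) ∂μ := by
    refine (setIntegral_eq_integral_of_forall_compl_eq_zero fun y hy => hf _ fun hmem => hy ?_).symm
    exact ⟨x + y, hmem, x, hx, add_sub_cancel_left x y⟩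
  rw [h]
  have hKL : IsCompact (K - L) := sub_eq_add_neg K L ▸ hK.add hL.neg
  exact norm_setIntegral_le_of_norm_le_const hKL.measure_lt_top fun y _ => hC _

variable [CompleteSpace E]

theorem hasFTaylorSeriesUpTo_translateAverage {μ : Measure V} [IsFiniteMeasureOnCompacts μ]
    {f : V → E} (hf : ContDiff ℝ ∞ f) (hc : HasCompactSupport f) :
    HasFTaylorSeriesUpTo ∞ (translateAverage μ f)
      fun x n => translateAverage μ (iteratedFDeriv ℝ n f) x := by
  have key : ∀ (m : ℕ) (x : V), HasFDerivAt (translateAverage μ (iteratedFDeriv ℝ m f))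
      (translateAverage μ (fderiv ℝ (iteratedFDeriv ℝ m f)) x) x := fun m x =>
    hasFDerivAt_translateAverage
      (hf.iteratedFDeriv_right (m := 1) (i := m) (by exact_mod_cast le_top))
      (hc.iteratedFDeriv m) x
  refine ⟨fun x => ?_, fun m _ x => ?_, fun m _ => ?_⟩
  · exact ((continuousMultilinearCurryFin0 ℝ V E).toContinuousLinearEquiv.toContinuousLinearMap
      |>.integral_comp_comm (integrable_comp_add_left (hf.continuous_iteratedFDeriv
        (m := 0) (by simp)) (hc.iteratedFDeriv 0) x)).symm.trans
      (integral_congr_ae (Eventually.of_forall fun y => by simp))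
  · have h := key m x
    rw [fderiv_iteratedFDeriv] at h
    refine h.congr_fderiv ?_
    have hi := integrable_comp_add_left (μ := μ) (hf.continuous_iteratedFDeriv (m := m + 1)
      (by exact_mod_cast le_top)) (hc.iteratedFDeriv (m + 1)) x
    let L : (V [×m + 1]→L[ℝ] E) →L[ℝ] (V →L[ℝ] V [×m]→L[ℝ] E) :=
      ((continuousMultilinearCurryLeftEquiv ℝ (fun _ : Fin (m + 1) => V)
        E).toContinuousLinearEquiv : _ →L[ℝ] _)
    exact ContinuousLinearMap.integral_comp_comm (𝕜 := ℝ) (Fₗ := V →L[ℝ] V [×m]→L[ℝ] E) L hi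
  · exact continuous_iff_continuousAt.2 fun x => (key m x).continuousAt

theorem contDiff_translateAverage {μ : Measure V} [IsFiniteMeasureOnCompacts μ]
    {f : V → E} (hf : ContDiff ℝ ∞ f) (hc : HasCompactSupport f) :
    ContDiff ℝ ∞ (translateAverage μ f) :=
  HasFTaylorSeriesUpTo.contDiff (n := ⊤) (hasFTaylorSeriesUpTo_translateAverage hf hc)

theorem iteratedFDeriv_translateAverage {μ : Measure V} [IsFiniteMeasureOnCompacts μ]
    {f : V → E} (hf : ContDiff ℝ ∞ f) (hc : HasCompactSupport f) (n : ℕ) (x : V) :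
    iteratedFDeriv ℝ n (translateAverage μ f) x =
      translateAverage μ (iteratedFDeriv ℝ n f) x :=
  ((hasFTaylorSeriesUpTo_translateAverage hf hc).eq_iteratedFDeriv
    (by exact_mod_cast le_top) x).symm

end TranslateAverage

/-! ### The spline transform of a test function and its cutoff -/

section SplineTransform

open scoped ContDiff Pointwise

variable {V : Type*} [NormedAddCommGroup V] [NormedSpace ℝ V]

@[simp]
theorem shift_apply (φ : 𝓓((⊤ : Opens V), ℝ)) (x y : V) : shift φ x y = φ (x + y) := rfl

theorem lineDerivOp_testFunction_apply (φ : 𝓓((⊤ : Opens V), ℝ)) (a x : V) :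
    (∂_{a} φ) x = fderiv ℝ φ x a := by
  rw [TestFunction.lineDerivOp_eq_lineDerivCLM ℝ, TestFunction.lineDerivCLM_eq_fderivCLM,
    TestFunction.fderivCLM_apply_of_le _ (by simp)]

variable [MeasurableSpace V] [BorelSpace V] [FiniteDimensional ℝ V]
variable {κ : Type*} [Fintype κ] {c : κ → V}

omit [FiniteDimensional ℝ V] in
theorem setIntegral_orthant_eq (f : 𝓓((⊤ : Opens V), ℝ)) :
    ∫ y, f y ∂orthantMeasure c =
      ∫ t in {t : κ → ℝ | ∀ k, 0 ≤ t k}, f (∑ k, t k • c k) := by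
  have hcont : Continuous fun t : κ → ℝ => ∑ k, t k • c k := by fun_prop
  rw [orthantMeasure, integral_map hcont.aemeasurable f.aestronglyMeasurable]

theorem multivariateSpline_shift (hc : ∃ u : Module.Dual ℝ V, ∀ k, 0 < u (c k))
    (φ : 𝓓((⊤ : Opens V), ℝ)) (x : V) :
    multivariateSpline c (shift φ x) = translateAverage (orthantMeasure c) φ x := by
  rw [multivariateSpline_apply c hc, ← setIntegral_orthant_eq]
  rfl

omit [FiniteDimensional ℝ V] in
theorem translateAverage_orthantMeasure (φ : 𝓓((⊤ : Opens V), ℝ)) (x : V) :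
    translateAverage (orthantMeasure c) φ x =
      ∫ t in {t : κ → ℝ | ∀ k, 0 ≤ t k}, φ (x + ∑ k, t k • c k) :=
  setIntegral_orthant_eq (shift φ x)

/-- The set of the points of the half space `-1 ≤ u` from which `K` is reached by adding a
nonnegative combination of `c` is contained in a compact set. -/
theorem exists_compact_translateAverage_eq_zero {u : Module.Dual ℝ V} (hu : ∀ k, 0 < u (c k))
    (K : Compacts V) : ∃ L : Compacts V, ∀ φ : 𝓓((⊤ : Opens V), ℝ), (∀ z ∉ K, φ z = 0) →
      ∀ x ∉ L, -1 ≤ u x → translateAverage (orthantMeasure c) φ x = 0 := by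
  have hucont : Continuous u := u.continuous_of_finiteDimensional
  obtain ⟨C, hC⟩ := (K.isCompact.image hucont).bddAbove
  -- With `u ≤ C` on `K` and `u x ≥ -1`, reaching `K` from `x` forces `t k * u (c k) ≤ C + 1` for
  -- every `k`.
  have hL : IsCompact ((fun p : V × (κ → ℝ) => p.1 - ∑ k, p.2 k • c k) ''
      ((K : Set V) ×ˢ Set.Icc 0 fun k => (C + 1) / u (c k))) :=
    (K.isCompact.prod isCompact_Icc).image (by fun_prop)
  refine ⟨⟨_, hL⟩, fun φ hφ x hx hux => ?_⟩
  rw [translateAverage_orthantMeasure]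
  refine setIntegral_eq_zero_of_forall_eq_zero fun t ht => hφ _ fun hmem => hx ?_
  refine ⟨(_, t), ⟨hmem, fun k => ht k, fun k => ?_⟩, add_sub_cancel_right _ _⟩
  have h1 : u x + ∑ k, t k * u (c k) ≤ C := by
    simpa using hC ⟨_, hmem, rfl⟩
  have h2 : t k * u (c k) ≤ ∑ k, t k * u (c k) :=
    Finset.single_le_sum (f := fun k => t k * u (c k))
      (fun j _ => mul_nonneg (ht j) (hu j).le) (Finset.mem_univ k)
  change t k ≤ (C + 1) / u (c k)
  rw [le_div_iff₀ (hu k)]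
  linarith

/-- Averaging the translates of test functions supported in `K` and multiplying by a smooth
function `h` is continuous, provided that the results are supported in a fixed compact set. -/
theorem exists_cutoffAverageCLM_supportedIn {μ : Measure V} [IsFiniteMeasureOnCompacts μ]
    {h : V → ℝ} (hh : ContDiff ℝ ∞ h) (K L : Compacts V)
    (hsupp : ∀ f : 𝓓_{K}(V, ℝ), ∀ x ∉ L, h x * translateAverage μ f x = 0) :
    ∃ S : 𝓓_{K}(V, ℝ) →L[ℝ] 𝓓_{L}(V, ℝ), ∀ f x, S f x = h x * translateAverage μ f x := by
  refine ⟨ContDiffMapSupportedIn.mkCLM ℝ (fun f x => h x * translateAverage μ f x)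
    (fun f g x => ?_) (fun a f x => ?_) (fun f => ?_) (fun f x hx => hsupp f x hx)
    (fun n _ => ?_), fun f x => rfl⟩
  · rw [← mul_add]
    congr 1
    exact integral_add (integrable_comp_add_left f.continuous f.hasCompactSupport x)
      (integrable_comp_add_left g.continuous g.hasCompactSupport x)
  · rw [smul_eq_mul, mul_left_comm]
    congr 1
    exact integral_const_mul a _
  · exact hh.mul (contDiff_translateAverage f.contDiff f.hasCompactSupport)
  · have hb : ∀ i, ∃ B, ∀ x ∈ L, ‖iteratedFDeriv ℝ i h x‖ ≤ B := fun i =>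
      L.isCompact.exists_bound_of_continuousOn
        (hh.continuous_iteratedFDeriv (m := i) (by exact_mod_cast le_top)).continuousOn
    choose B hB using hb
    let ν : ℝ := μ.real ((K : Set V) - L)
    -- The Leibniz rule involves all derivatives of the average up to order `n`, hence all seminorms
    -- up to `n`.
    refine ⟨Finset.Iic n, ∑ i ∈ Finset.range (n + 1), (n.choose i : ℝ) * |B i| * ν,
      by positivity, fun f x hx => ?_⟩
    have hA : ContDiff ℝ ∞ (translateAverage μ f) :=
      contDiff_translateAverage f.contDiff f.hasCompactSupport
    refine (norm_iteratedFDeriv_mul_le hh hA x (by exact_mod_cast le_top)).trans ?_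
    rw [Finset.sum_mul]
    refine Finset.sum_le_sum fun i hi => ?_
    have h1 : ‖iteratedFDeriv ℝ (n - i) (translateAverage μ f) x‖ ≤
        ((Finset.Iic n).sup fun j => N[ℝ]_{K, j}) f * ν := by
      rw [iteratedFDeriv_translateAverage f.contDiff f.hasCompactSupport]
      refine norm_translateAverage_le K.isCompact L.isCompact
        (fun z hz => f.iteratedFDeriv_zero_on_compl hz) (fun z => ?_) hx
      exact (ContDiffMapSupportedIn.norm_iteratedFDeriv_apply_le_seminorm_top ℝ).trans
        (Seminorm.le_finset_sup_apply (p := fun j => N[ℝ; ℝ]_{K, j})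
          (Finset.mem_Iic.2 (Nat.sub_le n i)))
    have h2 : ‖iteratedFDeriv ℝ i h x‖ ≤ |B i| := (hB i x hx).trans (le_abs_self _)
    calc _ ≤ (n.choose i : ℝ) * |B i| * (((Finset.Iic n).sup fun j => N[ℝ]_{K, j}) f * ν) := by
          gcongr
      _ = _ := by ring

/-- The transform is multiplied by a bump function of `u x`, equal to 1 for `|u x| ≤ 1/2` and to 0
for `|u x| ≥ 1`. The product has compact support depending only on the support of `φ`, so continuity
can be checked on each space of test functions with fixed compact support. -/
theorem exists_cutoffSplineCLM {u : Module.Dual ℝ V} (hu : ∀ k, 0 < u (c k)) :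
    ∃ M : 𝓓((⊤ : Opens V), ℝ) →L[ℝ] 𝓓((⊤ : Opens V), ℝ), ∀ φ x, |u x| < 1 / 2 →
      M φ x = multivariateSpline c (shift φ x) := by
  have := isFiniteMeasureOnCompacts_orthantMeasure c ⟨u, hu⟩
  let η : ContDiffBump (0 : ℝ) := ⟨1 / 2, 1, by norm_num, by norm_num⟩
  let μ := orthantMeasure c
  let h : V → ℝ := fun x => η (u x)
  have hh : ContDiff ℝ ∞ h := η.contDiff.comp u.toContinuousLinearMap.contDiff
  choose L hL using exists_compact_translateAverage_eq_zero hu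
  have hzero : ∀ (K : Compacts V) (φ : 𝓓((⊤ : Opens V), ℝ)), (∀ z ∉ K, φ z = 0) →
      ∀ x ∉ L K, h x * translateAverage μ φ x = 0 := by
    intro K φ hφ x hx
    by_cases hux : |u x| < 1
    · rw [hL K φ hφ x hx (abs_lt.1 hux).1.le, mul_zero]
    · have : h x = 0 := η.zero_of_le_dist (by simpa using hux)
      rw [this, zero_mul]
  choose S hS using fun K : Compacts V => exists_cutoffAverageCLM_supportedIn (μ := μ) hh K (L K)
    fun f => hzero K (TestFunction.ofSupportedIn (Set.subset_univ _) f)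
      fun z hz => f.zero_on_compl hz
  let A : 𝓓((⊤ : Opens V), ℝ) → 𝓓((⊤ : Opens V), ℝ) := fun φ =>
    { toFun x := h x * translateAverage μ φ x
      contDiff' := hh.mul (contDiff_translateAverage φ.contDiff φ.hasCompactSupport)
      hasCompactSupport' := HasCompactSupport.intro (L ⟨_, φ.hasCompactSupport⟩).isCompact
        (hzero ⟨_, φ.hasCompactSupport⟩ φ fun z hz => image_eq_zero_of_notMem_tsupport hz)
      tsupport_subset' := fun _ _ => trivial }
  refine ⟨TestFunction.limitCLM ℝ A (fun K _ =>
    (TestFunction.ofSupportedInCLM ℝ (Set.subset_univ (L K : Set V))).comp (S K)) ?_, ?_⟩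
  · intro K _ f
    ext x
    exact (hS K f x).symm
  · intro φ x hx
    have h1 : h x = 1 := η.one_of_mem_closedBall (mem_closedBall_zero_iff.2 hx.le)
    rw [multivariateSpline_shift ⟨u, hu⟩]
    change h x * translateAverage μ φ x = _
    rw [h1, one_mul]

theorem hasFDerivAt_multivariateSpline_shift (hc : ∃ u : Module.Dual ℝ V, ∀ k, 0 < u (c k))
    (φ : 𝓓((⊤ : Opens V), ℝ)) (x : V) : ∃ D : V →L[ℝ] ℝ,
    HasFDerivAt (fun x => multivariateSpline c (shift φ x)) D x ∧
      ∀ a, D a = multivariateSpline c (shift (∂_{a} φ) x) := by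
  have := isFiniteMeasureOnCompacts_orthantMeasure c hc
  have hφ : ContDiff ℝ 1 φ := φ.contDiff.of_le (by exact_mod_cast le_top)
  simp_rw [multivariateSpline_shift hc]
  refine ⟨_, hasFDerivAt_translateAverage hφ φ.hasCompactSupport x, fun a => ?_⟩
  rw [translateAverage, ContinuousLinearMap.integral_apply (integrable_comp_add_left
    (hφ.continuous_fderiv one_ne_zero) (φ.hasCompactSupport.fderiv (𝕜 := ℝ)) x)]
  simp_rw [translateAverage, lineDerivOp_testFunction_apply]

end SplineTransform

/-! ### Differentiation removes a vector from the spline -/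

section Fubini

open scoped ContDiff

/-- The fundamental theorem of calculus; since `a ≠ 0`, the line is a closed embedding and the
restriction of `φ` to it has compact support. -/
theorem integral_Ici_lineDeriv {V : Type*} [NormedAddCommGroup V] [NormedSpace ℝ V]
    (φ : 𝓓((⊤ : Opens V), ℝ)) {a : V} (ha : a ≠ 0) (x : V) :
    ∫ s in Set.Ici (0 : ℝ), (∂_{a} φ) (x + s • a) = -φ x := by
  have hsmul : Topology.IsClosedEmbedding fun s : ℝ => x + s • a :=
    (Homeomorph.addLeft x).isClosedEmbedding.comp (isClosedEmbedding_smul_left ha)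
  have hφ : ContDiff ℝ 1 φ := φ.contDiff.of_le (by exact_mod_cast le_top)
  have hline : ContDiff ℝ 1 fun s : ℝ => x + s • a := by fun_prop
  have hd : deriv (fun s : ℝ => φ (x + s • a)) = fun s => (∂_{a} φ) (x + s • a) := by
    funext s
    rw [lineDerivOp_testFunction_apply]
    have h1 : HasDerivAt (fun s : ℝ => x + s • a) a s := by
      simpa using ((hasDerivAt_id s).smul_const a).const_add x
    exact ((hφ.differentiable one_ne_zero (x + s • a)).hasFDerivAt.comp_hasDerivAt s h1).deriv
  rw [integral_Ici_eq_integral_Ioi, ← hd]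
  refine (HasCompactSupport.integral_Ioi_deriv_eq (hφ.comp hline)
    (φ.hasCompactSupport.comp_isClosedEmbedding hsmul) 0).trans ?_
  simp

variable {V : Type*} [NormedAddCommGroup V] [NormedSpace ℝ V] [MeasurableSpace V] [BorelSpace V]
  [FiniteDimensional ℝ V] {ι : Type*}

/-- Fubini splits the orthant into the coordinates in `W` and the coordinate `i`; the inner integral
over the latter is that of a derivative along a half-line. -/
theorem translateAverage_orthantMeasure_lineDeriv [DecidableEq ι] {c : ι → V} {W : Finset ι}
    {i : ι} (hi : i ∉ W)
    (hc : ∃ u : Module.Dual ℝ V, ∀ k ∈ W ∪ {i}, 0 < u (c k)) (φ : 𝓓((⊤ : Opens V), ℝ)) (x : V) :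
    translateAverage (orthantMeasure fun k : ↥(W ∪ {i}) => c k)
        (∂_{c i} φ : 𝓓((⊤ : Opens V), ℝ)) x =
      -translateAverage (orthantMeasure fun k : W => c k) φ x := by
  obtain ⟨u, hu⟩ := hc
  have := isFiniteMeasureOnCompacts_orthantMeasure (fun k : ↥(W ∪ {i}) => c k)
    ⟨u, fun k => hu k k.2⟩
  have hci : c i ≠ 0 := fun h => by simpa [h] using hu i (by simp)
  have hdisj : Disjoint W {i} := Finset.disjoint_singleton_right.2 hi
  let e := MeasurableEquiv.piFinsetUnion (fun _ : ι => ℝ) hdisj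
  have he : MeasurePreserving e volume volume := volume_preserving_piFinsetUnion _ hdisj
  let e₁ := MeasurableEquiv.funUnique ↥({i} : Finset ι) ℝ
  have he₁ : MeasurePreserving e₁ volume volume := volume_preserving_funUnique _ _
  have hleft : ∀ t s (k : W), e (t, s) ⟨k, Finset.mem_union_left _ k.2⟩ = t k := fun t s k =>
    Equiv.piFinsetUnion_left (fun _ : ι => ℝ) hdisj k.2 _
  have hright : ∀ t s (k : ↥({i} : Finset ι)),
      e (t, s) ⟨k, Finset.mem_union_right _ k.2⟩ = s k := fun t s k =>
    Equiv.piFinsetUnion_right (fun _ : ι => ℝ) hdisj k.2 _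
  have hsum : ∀ t s, ∑ k, e (t, s) k • c k = ∑ k, t k • c k + e₁ s • c i := by
    intro t s
    rw [← (Equiv.Finset.union W {i} hdisj).sum_comp, Fintype.sum_sum_type]
    congr 1
    · exact Finset.sum_congr rfl fun k _ => congrArg (· • c k) (hleft t s k)
    · rw [Fintype.sum_unique]
      exact congrArg (· • c i) (hright t s default)
  have hpre : e ⁻¹' {t | ∀ k, 0 ≤ t k} = {t | ∀ k, 0 ≤ t k} ×ˢ {s | ∀ k, 0 ≤ s k} := by
    ext ⟨t, s⟩
    constructor
    · exact fun h => ⟨fun k => (h _).trans_eq (hleft t s k), fun k => (h _).trans_eq (hright t s k)⟩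
    · rintro ⟨ht, hs⟩ ⟨k, hk⟩
      rcases Finset.mem_union.1 hk with h | h
      · exact (ht ⟨k, h⟩).trans_eq (hleft t s ⟨k, h⟩).symm
      · exact (hs ⟨k, h⟩).trans_eq (hright t s ⟨k, h⟩).symm
  have hpre₁ : e₁ ⁻¹' Set.Ici 0 = {s | ∀ k, 0 ≤ s k} := by
    ext s
    exact ⟨fun h k => (Subsingleton.elim default k) ▸ h, fun h => h default⟩
  have hcont : Continuous fun t : ↥(W ∪ {i}) → ℝ => ∑ k, t k • c k := by fun_prop
  have hint : IntegrableOn (fun t : ↥(W ∪ {i}) → ℝ => (∂_{c i} φ) (x + ∑ k, t k • c k))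
      {t | ∀ k, 0 ≤ t k} :=
    (integrable_comp_add_left (μ := orthantMeasure fun k : ↥(W ∪ {i}) => c k)
      (∂_{c i} φ).continuous (∂_{c i} φ).hasCompactSupport x).comp_aemeasurable
      hcont.aemeasurable
  rw [translateAverage_orthantMeasure, translateAverage_orthantMeasure,
    ← he.setIntegral_preimage_emb e.measurableEmbedding, hpre]
  have hint' := (he.integrableOn_comp_preimage e.measurableEmbedding).2 hint
  rw [hpre] at hint'
  refine (setIntegral_prod _ hint').trans ?_
  rw [← integral_neg]
  refine integral_congr_ae (Eventually.of_forall fun t => ?_)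
  change ∫ s in _, _ = -φ (x + ∑ k : W, t k • c k)
  rw [← integral_Ici_lineDeriv φ hci, ← he₁.setIntegral_preimage_emb e₁.measurableEmbedding, hpre₁]
  refine integral_congr_ae (Eventually.of_forall fun s => ?_)
  exact congrArg (∂_{c i} φ : 𝓓((⊤ : Opens V), ℝ))
    ((congrArg (x + ·) (hsum t s)).trans (add_assoc _ _ _).symm)

end Fubini

/-! ### Splines with sign changes -/

section SignedSpline

variable {V : Type*} [NormedAddCommGroup V] [NormedSpace ℝ V] {ι : Type*}

open Classical in
/-- The family obtained from `X` by changing the signs of the vectors with index in `B`. -/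
def flipSigns (X : ι → V) (B : Finset ι) (i : ι) : V := if i ∈ B then -X i else X i

/-- The sign by which `flipSigns X B i` differs from `X i`. -/
def flipSign (B : Finset ι) (i : ι) : ℝ := open Classical in if i ∈ B then -1 else 1

theorem lineDerivOp_flipSigns (X : ι → V) (B : Finset ι) (i : ι) (φ : 𝓓((⊤ : Opens V), ℝ)) :
    ∂_{flipSigns X B i} φ = flipSign B i • ∂_{X i} φ := by
  ext x
  change (∂_{flipSigns X B i} φ) x = flipSign B i * (∂_{X i} φ) x
  rw [lineDerivOp_testFunction_apply, lineDerivOp_testFunction_apply, flipSigns, flipSign]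
  split_ifs <;> simp

variable [MeasurableSpace V] [BorelSpace V]

/-- The spline `(-1)^{|B ∩ W|} T_c`, where `c` is the part of `flipSigns X B` with index in `W`. -/
def signedSpline (X : ι → V) (B W : Finset ι) : 𝓓'((⊤ : Opens V), ℝ) :=
  (∏ i ∈ W, flipSign B i) • multivariateSpline fun i : W => flipSigns X B i

theorem signedSpline_apply (X : ι → V) (B W : Finset ι) (φ : 𝓓((⊤ : Opens V), ℝ)) :
    signedSpline X B W φ =
      (∏ i ∈ W, flipSign B i) * multivariateSpline (fun i : W => flipSigns X B i) φ := rfl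

theorem prod_flipSign {B W : Finset ι} (h : B ⊆ W) :
    ∏ i ∈ W, flipSign B i = (-1) ^ B.card :=
  (Finset.prod_subset h fun _ _ hi => if_neg hi).symm.trans
    ((Finset.prod_congr rfl fun _ hi => if_pos hi).trans (Finset.prod_const _))

variable [FiniteDimensional ℝ V]

/-- A flipped vector contributes one sign to the prefactor and one to the derivative, and these
cancel. The remaining minus sign is that of integration by parts. -/
theorem signedSpline_shift_lineDeriv {X : ι → V} {B W : Finset ι}
    (hW : ∃ u : Module.Dual ℝ V, ∀ k ∈ W, 0 < u (flipSigns X B k)) [DecidableEq ι] {i : ι}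
    (hi : i ∈ W) (φ : 𝓓((⊤ : Opens V), ℝ)) (x : V) :
    signedSpline X B W (shift (∂_{X i} φ) x) = -signedSpline X B (W.erase i) (shift φ x) := by
  obtain ⟨u, hu⟩ := hW
  have hsq : flipSign B i * flipSign B i = 1 := by
    unfold flipSign
    split_ifs <;> norm_num
  have hlin : ∂_{X i} φ = flipSign B i • ∂_{flipSigns X B i} φ := by
    rw [lineDerivOp_flipSigns, smul_smul, hsq, one_smul]
  obtain ⟨W', hiW', rfl⟩ : ∃ W', i ∉ W' ∧ W = W' ∪ {i} :=
    ⟨W.erase i, Finset.notMem_erase i W, by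
      rw [Finset.union_comm, ← Finset.insert_eq, Finset.insert_erase hi]⟩
  have herase : (W' ∪ {i}).erase i = W' := by
    rw [Finset.union_comm, ← Finset.insert_eq, Finset.erase_insert hiW']
  have key := translateAverage_orthantMeasure_lineDeriv (c := flipSigns X B) hiW' ⟨u, hu⟩ φ x
  rw [← multivariateSpline_shift (c := fun k : ↥(W' ∪ {i}) => flipSigns X B k)
      ⟨u, fun k => hu k k.2⟩,
    ← multivariateSpline_shift (c := fun k : W' => flipSigns X B k)
      ⟨u, fun k => hu k (Finset.mem_union_left _ k.2)⟩] at key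
  have hshift : shift (flipSign B i • ∂_{flipSigns X B i} φ) x =
      flipSign B i • shift (∂_{flipSigns X B i} φ) x := rfl
  rw [herase, hlin, hshift, map_smul, signedSpline_apply, signedSpline_apply, key,
    Finset.prod_union (Finset.disjoint_singleton_right.2 hiW'), Finset.prod_singleton, smul_eq_mul]
  linear_combination (-(∏ i ∈ W', flipSign B i) *
    multivariateSpline (fun i : W' => flipSigns X B i) (shift φ x)) * hsq

theorem signedSpline_shift_eq_zero {X : ι → V} {B W : Finset ι}
    (hW : ∃ u : Module.Dual ℝ V, ∀ k ∈ W, 0 < u (flipSigns X B k)) {s : Submodule ℝ V}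
    (hs : ∀ i ∈ W, X i ∈ s) {φ : 𝓓((⊤ : Opens V), ℝ)} (hφ : ∀ x ∈ s, φ x = 0) {x : V}
    (hx : x ∈ s) : signedSpline X B W (shift φ x) = 0 := by
  obtain ⟨u, hu⟩ := hW
  rw [signedSpline_apply,
    multivariateSpline_apply (fun k : W => flipSigns X B k) ⟨u, fun k => hu k k.2⟩]
  rw [setIntegral_eq_zero_of_forall_eq_zero, mul_zero]
  intro t _
  refine hφ _ (s.add_mem hx (s.sum_mem fun k _ => s.smul_mem _ ?_))
  unfold flipSigns
  split_ifs
  · exact s.neg_mem (hs k k.2)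
  · exact hs k k.2

theorem signedSpline_empty (X : ι → V) (B : Finset ι) (φ : 𝓓((⊤ : Opens V), ℝ)) :
    signedSpline X B ∅ φ = φ 0 := by
  rw [signedSpline_apply, multivariateSpline_apply _ ⟨0, fun k => (Finset.notMem_empty _ k.2).elim⟩]
  have : {t : ↥(∅ : Finset ι) → ℝ | ∀ k, 0 ≤ t k} = Set.univ :=
    Set.eq_univ_of_forall fun t k => (Finset.notMem_empty _ k.2).elim
  rw [this, Measure.restrict_univ, volume_pi, Measure.pi_of_empty _ 0, integral_dirac]
  simp

/-- As `u` vanishes on `r`, the slab `|u| < 1/2`, where the cutoff is invisible, is an open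
neighbourhood of `r`. -/
theorem exists_signedSplineCLM {X : ι → V} {B W : Finset ι} {u : Module.Dual ℝ V}
    (hu : ∀ k ∈ W, 0 < u (flipSigns X B k)) {r : Submodule ℝ V} (hr : u ∈ r.dualAnnihilator) :
    ∃ M : 𝓓((⊤ : Opens V), ℝ) →L[ℝ] 𝓓((⊤ : Opens V), ℝ), ∀ φ,
      ∀ᶠ x in 𝓝ˢ (r : Set V), M φ x = signedSpline X B W (shift φ x) := by
  obtain ⟨M, hM⟩ := exists_cutoffSplineCLM (c := fun k : W => flipSigns X B k) (u := u)
    fun k => hu k k.2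
  refine ⟨(∏ i ∈ W, flipSign B i) • M, fun φ => ?_⟩
  have hopen : IsOpen {x | |u x| < 1 / 2} :=
    isOpen_lt u.continuous_of_finiteDimensional.abs continuous_const
  filter_upwards [hopen.mem_nhdsSet.2 fun x hx => by
    simp [(Submodule.mem_dualAnnihilator u).1 hr x hx]] with x hx
  rw [signedSpline_apply, ← hM φ x hx]
  rfl

theorem hasFDerivAt_signedSpline_shift {X : ι → V} {B W : Finset ι}
    (hW : ∃ u : Module.Dual ℝ V, ∀ k ∈ W, 0 < u (flipSigns X B k))
    (φ : 𝓓((⊤ : Opens V), ℝ)) (x : V) : ∃ D : V →L[ℝ] ℝ,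
    HasFDerivAt (fun x => signedSpline X B W (shift φ x)) D x ∧
      ∀ a, D a = signedSpline X B W (shift (∂_{a} φ) x) := by
  obtain ⟨u, hu⟩ := hW
  obtain ⟨D, hD, hDa⟩ := hasFDerivAt_multivariateSpline_shift
    (c := fun k : W => flipSigns X B k) ⟨u, fun k => hu k k.2⟩ φ x
  refine ⟨_, hD.const_mul (∏ i ∈ W, flipSign B i), fun a => ?_⟩
  rw [signedSpline_apply, ← hDa]
  rfl

theorem lineDeriv_eventuallyEq_signedSpline_shift {X : ι → V} {B W : Finset ι}
    (hW : ∃ u : Module.Dual ℝ V, ∀ k ∈ W, 0 < u (flipSigns X B k)) {C : Set V}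
    {φ ψ : 𝓓((⊤ : Opens V), ℝ)} (h : ∀ᶠ x in 𝓝ˢ C, ψ x = signedSpline X B W (shift φ x))
    (a : V) :
    ∀ᶠ x in 𝓝ˢ C, (∂_{a} ψ) x = signedSpline X B W (shift (∂_{a} φ) x) := by
  filter_upwards [h.eventually_nhdsSet] with x hx
  obtain ⟨D, hD, hDa⟩ := hasFDerivAt_signedSpline_shift hW φ x
  rw [lineDerivOp_testFunction_apply, ← hDa,
    (hD.congr_of_eventuallyEq (show (ψ : V → ℝ) =ᶠ[𝓝 x] _ from hx)).fderiv]

end SignedSpline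

/-! ### Calculus of convolutions with signed splines -/

section ConvolutionCalculus

variable {𝕜 : Type*} [RCLike 𝕜] {V : Type*} [NormedAddCommGroup V] [NormedSpace ℝ V]
variable {ι : Type*}

theorem apply_eq_of_mem_distributionsOn {r : Submodule ℝ V} {g : 𝓓'((⊤ : Opens V), 𝕜)}
    (hg : g ∈ distributionsOn 𝕜 r) {φ ψ : 𝓓((⊤ : Opens V), ℝ)} (h : ∀ x ∈ r, φ x = ψ x) :
    g φ = g ψ := by
  rw [← sub_eq_zero, ← map_sub]
  exact hg _ fun x hx => sub_eq_zero.2 (h x hx)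

omit [NormedSpace ℝ V] in
theorem eq_on_of_eventually_nhdsSet {C : Set V} {p : V → Prop} (h : ∀ᶠ x in 𝓝ˢ C, p x) {x : V}
    (hx : x ∈ C) : p x :=
  (eventually_nhdsSet_iff_forall.1 h x hx).self_of_nhds

variable [MeasurableSpace V] [BorelSpace V] [FiniteDimensional ℝ V]
variable {X : ι → V} {B W : Finset ι} {r : Submodule ℝ V}

/-- Some linear form vanishing on `r` is positive on the part of `flipSigns X B` with index
in `W`. -/
def IsPointed (X : ι → V) (B W : Finset ι) (r : Submodule ℝ V) : Prop :=
  ∃ u ∈ r.dualAnnihilator, ∀ k ∈ W, 0 < u (flipSigns X B k)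

omit [MeasurableSpace V] [BorelSpace V] [FiniteDimensional ℝ V] in
theorem IsPointed.mono (h : IsPointed X B W r) {W' : Finset ι} (hW : W' ⊆ W) :
    IsPointed X B W' r := by
  obtain ⟨u, hur, hu⟩ := h
  exact ⟨u, hur, fun k hk => hu k (hW hk)⟩

omit [MeasurableSpace V] [BorelSpace V] [FiniteDimensional ℝ V] in
theorem IsPointed.exists_pos (h : IsPointed X B W r) :
    ∃ u : Module.Dual ℝ V, ∀ k ∈ W, 0 < u (flipSigns X B k) := by
  obtain ⟨u, _, hu⟩ := h
  exact ⟨u, hu⟩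

/-- The convolution is `g` composed with the cutoff transform `M`. Another choice of `ψ` agrees with
`M φ` on `r`, which is all that `g` sees; uniqueness follows by testing with `M φ` itself. -/
theorem existsUnique_isConvolution (hp : IsPointed X B W r) {g : 𝓓'((⊤ : Opens V), 𝕜)}
    (hg : g ∈ distributionsOn 𝕜 r) :
    ∃! U : 𝓓'((⊤ : Opens V), 𝕜), IsConvolution (r : Set V) (signedSpline X B W) g U := by
  obtain ⟨u, hur, hu⟩ := hp
  obtain ⟨M, hM⟩ := exists_signedSplineCLM hu hur
  refine ⟨(show 𝓓((⊤ : Opens V), ℝ) →L[ℝ] 𝕜 from g).comp M, fun φ ψ h => ?_, fun U hU => ?_⟩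
  · exact apply_eq_of_mem_distributionsOn hg fun x hx =>
      (eq_on_of_eventually_nhdsSet (hM φ) hx).trans (eq_on_of_eventually_nhdsSet h hx).symm
  · ext φ
    exact hU φ _ (hM φ)

theorem IsConvolution.dirDeriv (hp : IsPointed X B W r) {g U : 𝓓'((⊤ : Opens V), 𝕜)}
    (h : IsConvolution (r : Set V) (signedSpline X B W) g U) (a : V) :
    IsConvolution (r : Set V) (signedSpline X B W) (dirDeriv 𝕜 a g) (dirDeriv 𝕜 a U) := by
  intro φ ψ hψ
  rw [dirDeriv_apply_apply, dirDeriv_apply_apply,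
    h _ _ (lineDeriv_eventuallyEq_signedSpline_shift hp.exists_pos hψ a)]

/-- If `ψ` represents the shorter spline applied to the translates of `φ`, then `-ψ` represents the
full one applied to those of `∂_{X i} φ`. -/
theorem IsConvolution.dirDeriv_erase [DecidableEq ι] (hp : IsPointed X B W r)
    {g U : 𝓓'((⊤ : Opens V), 𝕜)}
    (h : IsConvolution (r : Set V) (signedSpline X B W) g U) {i : ι} (hi : i ∈ W) :
    IsConvolution (r : Set V) (signedSpline X B (W.erase i)) g
      (SplineDecomposition.dirDeriv 𝕜 (X i) U) := by
  intro φ ψ hψ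
  rw [dirDeriv_apply_apply, h (∂_{X i} φ) (-ψ), map_neg, neg_neg]
  filter_upwards [hψ] with x hx
  rw [signedSpline_shift_lineDeriv hp.exists_pos hi, ← hx]
  rfl

omit [MeasurableSpace V] [BorelSpace V] [FiniteDimensional ℝ V] in
theorem diffOp_empty (X : ι → V) (f : 𝓓'((⊤ : Opens V), 𝕜)) : diffOp 𝕜 X ∅ f = f := rfl

omit [MeasurableSpace V] [BorelSpace V] [FiniteDimensional ℝ V] in
theorem diffOp_insert [DecidableEq ι] (X : ι → V) {Y : Finset ι} {i : ι} (hi : i ∉ Y)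
    (f : 𝓓'((⊤ : Opens V), 𝕜)) :
    diffOp 𝕜 X (insert i Y) f = dirDeriv 𝕜 (X i) (diffOp 𝕜 X Y f) :=
  LinearMap.congr_fun (Finset.noncommProd_insert_of_notMem Y i (fun i => dirDeriv 𝕜 (X i))
    (fun _ _ _ _ _ => dirDeriv_commute 𝕜 _ _) hi) f

omit [MeasurableSpace V] [BorelSpace V] [FiniteDimensional ℝ V] in
theorem diffOp_union [DecidableEq ι] (X : ι → V) {Y Z : Finset ι} (h : Disjoint Y Z)
    (f : 𝓓'((⊤ : Opens V), 𝕜)) :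
    diffOp 𝕜 X (Y ∪ Z) f = diffOp 𝕜 X Y (diffOp 𝕜 X Z f) :=
  LinearMap.congr_fun (Finset.noncommProd_union_of_disjoint h (fun i => dirDeriv 𝕜 (X i))
    fun _ _ _ _ _ => dirDeriv_commute 𝕜 _ _) f

theorem IsConvolution.diffOp (hp : IsPointed X B W r) {g U : 𝓓'((⊤ : Opens V), 𝕜)}
    (h : IsConvolution (r : Set V) (signedSpline X B W) g U) (Y : Finset ι) :
    IsConvolution (r : Set V) (signedSpline X B W) (diffOp 𝕜 X Y g) (diffOp 𝕜 X Y U) := by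
  classical
  induction Y using Finset.induction_on with
  | empty => simpa only [diffOp_empty] using h
  | insert i Y hi ih =>
    rw [diffOp_insert X hi, diffOp_insert X hi]
    exact ih.dirDeriv hp (X i)

theorem IsConvolution.diffOp_sdiff [DecidableEq ι] (hp : IsPointed X B W r)
    {g U : 𝓓'((⊤ : Opens V), 𝕜)}
    (h : IsConvolution (r : Set V) (signedSpline X B W) g U) {Y : Finset ι} (hY : Y ⊆ W) :
    IsConvolution (r : Set V) (signedSpline X B (W \ Y)) g
      (SplineDecomposition.diffOp 𝕜 X Y U) := by
  induction Y using Finset.induction_on with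
  | empty => simpa only [diffOp_empty, Finset.sdiff_empty] using h
  | insert i Y hi ih =>
    rw [diffOp_insert X hi, Finset.sdiff_insert]
    rw [Finset.insert_subset_iff] at hY
    exact (ih hY.2).dirDeriv_erase (hp.mono Finset.sdiff_subset)
      (Finset.mem_sdiff.2 ⟨hY.1, hi⟩)

theorem IsConvolution.mem_distributionsOn (hp : IsPointed X B W r) {s : Submodule ℝ V}
    (hrs : r ≤ s) (hs : ∀ i ∈ W, X i ∈ s) {g U : 𝓓'((⊤ : Opens V), 𝕜)}
    (hg : g ∈ distributionsOn 𝕜 r)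
    (h : IsConvolution (r : Set V) (signedSpline X B W) g U) : U ∈ distributionsOn 𝕜 s := by
  intro φ hφ
  have hpos := hp.exists_pos
  obtain ⟨u, hur, hu⟩ := hp
  obtain ⟨M, hM⟩ := exists_signedSplineCLM hu hur
  rw [h φ _ (hM φ)]
  refine hg _ fun x hx => ?_
  rw [eq_on_of_eventually_nhdsSet (hM φ) hx]
  exact signedSpline_shift_eq_zero hpos hs hφ (hrs hx)

theorem IsConvolution.eq_of_empty {g U : 𝓓'((⊤ : Opens V), 𝕜)}
    (h : IsConvolution (r : Set V) (signedSpline X B ∅) g U) : U = g := by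
  ext φ
  exact h φ φ (Eventually.of_forall fun x => by rw [signedSpline_empty, shift_apply, add_zero])

end ConvolutionCalculus

/-! ### Rational subspaces and regular faces -/

section RationalSubspaces

variable {V : Type*} [NormedAddCommGroup V] [NormedSpace ℝ V] {ι : Type*} [Fintype ι]
  {X : ι → V} {r s : Submodule ℝ V}

@[simp]
theorem mem_inside {i : ι} : i ∈ inside X r ↔ X i ∈ r := by simp [inside]

@[simp]
theorem mem_outside {i : ι} : i ∈ outside X r ↔ X i ∉ r := by simp [outside]

theorem IsRational.span_inside (hr : IsRational X r) :
    Submodule.span ℝ (X '' (inside X r : Set ι)) = r := by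
  obtain ⟨S, rfl⟩ := hr
  refine le_antisymm (Submodule.span_le.2 ?_) (Submodule.span_mono (Set.image_mono fun i hi => ?_))
  · rintro _ ⟨i, hi, rfl⟩
    exact mem_inside.1 hi
  · exact mem_inside.2 (Submodule.subset_span ⟨i, hi, rfl⟩)

theorem negativePart_subset_outside {F : Set (Module.Dual ℝ V)} :
    negativePart X r F ⊆ outside X r := by
  classical
  exact Finset.filter_subset _ _

theorem mem_negativePart {F : Set (Module.Dual ℝ V)} {i : ι} :
    i ∈ negativePart X r F ↔ i ∈ outside X r ∧ ∀ u ∈ F, u (X i) < 0 := by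
  simp [negativePart]

theorem IsRegularFace.isPointed {F : Set (Module.Dual ℝ V)} (hF : IsRegularFace X r F) :
    IsPointed X (negativePart X r F) (outside X r) r := by
  obtain ⟨u, hur, hu, rfl⟩ := hF
  refine ⟨u, hur, fun k hk => ?_⟩
  unfold flipSigns
  split_ifs with h
  · rw [map_neg, neg_pos]
    -- The regular vector `u` belongs to its own face.
    exact (mem_negativePart.1 h).2 u ⟨hur, fun i hi => mul_self_pos.2 (hu i hi)⟩
  · by_contra hk'
    have hneg : u (X k) < 0 := lt_of_le_of_ne (not_lt.1 hk') (hu k hk)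
    exact h (mem_negativePart.2 ⟨hk, fun v hv => neg_of_mul_pos_right (hv.2 k hk) hneg.le⟩)

theorem finite_isRational (X : ι → V) : Finite {r : Submodule ℝ V // IsRational X r} :=
  Set.finite_range fun S : Finset ι => Submodule.span ℝ (X '' (S : Set ι))

variable [MeasurableSpace V] [BorelSpace V]

theorem twistedSpline_eq_signedSpline (F : Set (Module.Dual ℝ V)) :
    twistedSpline X r F = signedSpline X (negativePart X r F) (outside X r) := by
  unfold twistedSpline signedSpline
  rw [prod_flipSign negativePart_subset_outside]
  rfl

end RationalSubspaces

/-! ### Cocircuits, triangularity and the direct sum -/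

section Decomposition

variable {𝕜 : Type*} [RCLike 𝕜] {V : Type*} [NormedAddCommGroup V] [NormedSpace ℝ V]
  {ι : Type*} [Fintype ι] {X : ι → V} {r s : Submodule ℝ V}

omit [Fintype ι] in
theorem diffOp_eq_zero_of_subset {Y Z : Finset ι} (h : Y ⊆ Z) {f : 𝓓'((⊤ : Opens V), 𝕜)}
    (hf : diffOp 𝕜 X Y f = 0) : diffOp 𝕜 X Z f = 0 := by
  classical
  rw [← Finset.sdiff_union_of_subset h, diffOp_union X Finset.sdiff_disjoint, hf, map_zero]

/-- Removing from `X∩r` the vectors outside `s` leaves a list inside `s`, which cannot span `r`; a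
minimal such sublist is a cocircuit. -/
theorem exists_isCocircuit_subset (hr : IsRational X r) (hrs : ¬r ≤ s) :
    ∃ Y ⊆ outside X s, IsCocircuit X (inside X r) Y := by
  classical
  have hne : Submodule.span ℝ (X '' ((inside X r : Set ι) \
      ((inside X r ∩ outside X s : Finset ι) : Set ι))) ≠
      Submodule.span ℝ (X '' (inside X r : Set ι)) := by
    refine fun h => hrs (hr.span_inside.ge.trans (h.ge.trans (Submodule.span_le.2 ?_)))
    rintro _ ⟨i, ⟨hi, hi'⟩, rfl⟩
    by_contra his
    exact hi' (Finset.mem_inter.2 ⟨hi, mem_outside.2 his⟩)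
  obtain ⟨Y, hY, hmin⟩ := exists_minimal_le_of_wellFoundedLT
    (fun Y : Finset ι => Y ⊆ inside X r ∧
      Submodule.span ℝ (X '' ((inside X r : Set ι) \ (Y : Set ι))) ≠
        Submodule.span ℝ (X '' (inside X r : Set ι))) (inside X r ∩ outside X s)
    ⟨Finset.inter_subset_left, hne⟩
  exact ⟨Y, hY.trans Finset.inter_subset_right, hmin⟩

theorem mem_dahmenMicchelli_inside (hr : IsRational X r) {g : 𝓓'((⊤ : Opens V), 𝕜)} :
    g ∈ dahmenMicchelli 𝕜 X (inside X r) ↔ g ∈ distributionsOn 𝕜 r ∧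
      ∀ Y, IsCocircuit X (inside X r) Y → diffOp 𝕜 X Y g = 0 := by
  simp only [dahmenMicchelli, hr.span_inside, Submodule.mem_inf, Submodule.mem_iInf,
    LinearMap.mem_ker]

theorem mem_spaceG {f : 𝓓'((⊤ : Opens V), 𝕜)} : f ∈ spaceG 𝕜 X ↔
    ∀ r, IsRational X r → diffOp 𝕜 X (outside X r) f ∈ distributionsOn 𝕜 r := by
  simp only [spaceG, Submodule.mem_iInf, Submodule.mem_comap]

/-- The complement of a cocircuit `Y` of `X ∩ r` in `X ∩ r` is `X ∩ t` for a rational subspace `t`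
properly contained in `r`. -/
theorem IsCocircuit.exists_outside_eq [DecidableEq ι] (hr : IsRational X r) {Y : Finset ι}
    (hY : IsCocircuit X (inside X r) Y) :
    ∃ t < r, IsRational X t ∧ outside X t = Y ∪ outside X r ∧ Disjoint Y (outside X r) := by
  obtain ⟨⟨hYr, hspan⟩, hmin⟩ := hY
  let t : Submodule ℝ V := Submodule.span ℝ (X '' ((inside X r : Set ι) \ (Y : Set ι)))
  rw [hr.span_inside] at hspan
  have htr : t ≤ r := Submodule.span_le.2 (by
    rintro _ ⟨i, hi, rfl⟩
    exact mem_inside.1 hi.1)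
  refine ⟨t, lt_of_le_of_ne htr hspan, ⟨inside X r \ Y, by rw [Finset.coe_sdiff]⟩, ?_, ?_⟩
  · ext i
    rw [mem_outside, Finset.mem_union, mem_outside]
    refine ⟨fun hit => ?_, ?_⟩
    · by_contra! h
      exact hit (Submodule.subset_span ⟨i, ⟨mem_inside.2 h.2, h.1⟩, rfl⟩)
    · rintro (hi | hi) hit
      -- If `X i` lay in `t`, putting `i` back would not enlarge the span, so `Y.erase i` would
      -- contradict the minimality of `Y`.
      · have hle := hmin (y := Y.erase i) ⟨(Finset.erase_subset i Y).trans hYr, fun h => ?_⟩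
          (Finset.erase_subset i Y) hi
        · exact Finset.notMem_erase i Y hle
        · refine hspan (le_antisymm htr (hr.span_inside.ge.trans
            (h.ge.trans (Submodule.span_le.2 ?_))))
          rintro _ ⟨j, ⟨hj, hj'⟩, rfl⟩
          by_cases hji : j = i
          · rw [hji]
            exact hit
          · exact Submodule.subset_span
              ⟨j, ⟨hj, fun hjY => hj' (Finset.mem_erase.2 ⟨hji, hjY⟩)⟩, rfl⟩
      · exact hi (htr hit)
  · rw [Finset.disjoint_left]
    exact fun i hi hi' => mem_outside.1 hi' (mem_inside.1 (hYr hi))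

theorem diffOp_outside_mem_dahmenMicchelli (hr : IsRational X r) {f : 𝓓'((⊤ : Opens V), 𝕜)}
    (hf : f ∈ spaceG 𝕜 X)
    (h : ∀ t < r, IsRational X t → diffOp 𝕜 X (outside X t) f = 0) :
    diffOp 𝕜 X (outside X r) f ∈ dahmenMicchelli 𝕜 X (inside X r) := by
  classical
  refine (mem_dahmenMicchelli_inside hr).2 ⟨mem_spaceG.1 hf r hr, fun Y hY => ?_⟩
  obtain ⟨t, htr, ht, hout, hdisj⟩ := hY.exists_outside_eq hr
  rw [← diffOp_union X hdisj, ← hout, h t htr ht]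

variable [MeasurableSpace V] [BorelSpace V] [FiniteDimensional ℝ V] {F : Set (Module.Dual ℝ V)}

theorem existsUnique_isConvolution_twistedSpline (hF : IsRegularFace X r F)
    {g : 𝓓'((⊤ : Opens V), 𝕜)} (hg : g ∈ distributionsOn 𝕜 r) :
    ∃! U : 𝓓'((⊤ : Opens V), 𝕜), IsConvolution (r : Set V) (twistedSpline X r F) g U := by
  rw [twistedSpline_eq_signedSpline]
  exact existsUnique_isConvolution hF.isPointed hg

theorem IsConvolution.diffOp_outside_mem (hF : IsRegularFace X r F) (hrs : r ≤ s)
    {g U : 𝓓'((⊤ : Opens V), 𝕜)} (hg : g ∈ distributionsOn 𝕜 r)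
    (h : IsConvolution (r : Set V) (twistedSpline X r F) g U) :
    SplineDecomposition.diffOp 𝕜 X (outside X s) U ∈ distributionsOn 𝕜 s := by
  classical
  rw [twistedSpline_eq_signedSpline] at h
  have hsub : outside X s ⊆ outside X r := fun i hi =>
    mem_outside.2 fun hir => mem_outside.1 hi (hrs hir)
  refine (h.diffOp_sdiff hF.isPointed hsub).mem_distributionsOn
    (hF.isPointed.mono Finset.sdiff_subset) hrs (fun i hi => ?_) hg
  by_contra his
  exact (Finset.mem_sdiff.1 hi).2 (mem_outside.2 his)

theorem IsConvolution.diffOp_outside_eq (hF : IsRegularFace X r F)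
    {g U : 𝓓'((⊤ : Opens V), 𝕜)} (h : IsConvolution (r : Set V) (twistedSpline X r F) g U) :
    SplineDecomposition.diffOp 𝕜 X (outside X r) U = g := by
  classical
  rw [twistedSpline_eq_signedSpline] at h
  have h' := h.diffOp_sdiff hF.isPointed subset_rfl
  rw [Finset.sdiff_self] at h'
  exact h'.eq_of_empty

theorem IsConvolution.eq_zero (hF : IsRegularFace X r F) {U : 𝓓'((⊤ : Opens V), 𝕜)}
    (h : IsConvolution (r : Set V) (twistedSpline X r F) 0 U) : U = 0 :=
  (existsUnique_isConvolution_twistedSpline hF (zero_mem _)).unique h fun _ _ _ => rfl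

/-- For a cocircuit `Y ⊆ X∖s` of `X∩r`, moving `∂_Y` onto `g` gives `∂_Y (T * g) = T * ∂_Y g = 0`.
-/
theorem IsConvolution.diffOp_outside_eq_zero (hr : IsRational X r) (hF : IsRegularFace X r F)
    (hrs : ¬r ≤ s) {g U : 𝓓'((⊤ : Opens V), 𝕜)}
    (hg : g ∈ dahmenMicchelli 𝕜 X (inside X r))
    (h : IsConvolution (r : Set V) (twistedSpline X r F) g U) :
    SplineDecomposition.diffOp 𝕜 X (outside X s) U = 0 := by
  obtain ⟨Y, hYs, hY⟩ := exists_isCocircuit_subset hr hrs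
  refine diffOp_eq_zero_of_subset hYs (IsConvolution.eq_zero hF ?_)
  rw [twistedSpline_eq_signedSpline] at h ⊢
  have h' := h.diffOp hF.isPointed Y
  rwa [((mem_dahmenMicchelli_inside hr).1 hg).2 Y hY] at h'

theorem component_le_spaceG (hr : IsRational X r) (hF : IsRegularFace X r F) :
    component 𝕜 X r F ≤ spaceG 𝕜 X := by
  rintro U ⟨g, hg, hU⟩
  refine mem_spaceG.2 fun s _ => ?_
  by_cases hrs : r ≤ s
  · exact hU.diffOp_outside_mem hF hrs ((mem_dahmenMicchelli_inside hr).1 hg).1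
  · rw [hU.diffOp_outside_eq_zero hr hF hrs hg]
    exact zero_mem _

theorem diffOp_outside_eq_zero_of_mem_component (hr : IsRational X r) (hF : IsRegularFace X r F)
    (hrs : ¬r ≤ s) {U : 𝓓'((⊤ : Opens V), 𝕜)} (hU : U ∈ component 𝕜 X r F) :
    diffOp 𝕜 X (outside X s) U = 0 := by
  obtain ⟨g, hg, hU⟩ := hU
  exact hU.diffOp_outside_eq_zero hr hF hrs hg

theorem eq_zero_of_mem_component (hF : IsRegularFace X r F)
    {U : 𝓓'((⊤ : Opens V), 𝕜)} (hU : U ∈ component 𝕜 X r F)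
    (h : diffOp 𝕜 X (outside X r) U = 0) : U = 0 := by
  obtain ⟨g, -, hU⟩ := hU
  rw [hU.diffOp_outside_eq hF] at h
  exact IsConvolution.eq_zero hF (h ▸ hU)

theorem exists_mem_component_diffOp_outside_eq (hr : IsRational X r) (hF : IsRegularFace X r F)
    {g : 𝓓'((⊤ : Opens V), 𝕜)} (hg : g ∈ dahmenMicchelli 𝕜 X (inside X r)) :
    ∃ U ∈ component 𝕜 X r F, diffOp 𝕜 X (outside X r) U = g := by
  obtain ⟨U, hU, -⟩ := existsUnique_isConvolution_twistedSpline hF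
    ((mem_dahmenMicchelli_inside hr).1 hg).1
  exact ⟨U, ⟨g, hg, hU⟩, hU.diffOp_outside_eq hF⟩

variable {F : Submodule ℝ V → Set (Module.Dual ℝ V)}

/-- Induction on the number `k` of dimensions still to be treated, subtracting from `f` its part in
dimension `n` at each step. -/
theorem mem_iSup_component_of_forall_finrank_lt
    (hF : ∀ r, IsRational X r → IsRegularFace X r (F r)) (k n : ℕ)
    (hkn : n + k = Module.finrank ℝ V + 1) {f : 𝓓'((⊤ : Opens V), 𝕜)} (hf : f ∈ spaceG 𝕜 X)
    (hzero : ∀ t, IsRational X t → Module.finrank ℝ t < n → diffOp 𝕜 X (outside X t) f = 0) :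
    f ∈ ⨆ r : {r : Submodule ℝ V // IsRational X r}, component 𝕜 X r.1 (F r.1) := by
  classical
  have := finite_isRational X
  have := Fintype.ofFinite {r : Submodule ℝ V // IsRational X r}
  induction k generalizing n f with
  | zero =>
    -- Here `n` exceeds `dim V`, so the vanishing hypothesis covers the span of all of `X`, for
    -- which `∂_{X∖t}` is the identity.
    let t : Submodule ℝ V := Submodule.span ℝ (X '' ((Finset.univ : Finset ι) : Set ι))
    have hout : outside X t = ∅ := Finset.eq_empty_of_forall_notMem fun i hi =>
      mem_outside.1 hi (Submodule.subset_span ⟨i, Finset.mem_coe.2 (Finset.mem_univ i), rfl⟩)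
    have hft : diffOp 𝕜 X (outside X t) f = 0 :=
      hzero t ⟨_, rfl⟩ (by have := t.finrank_le; omega)
    rw [hout, diffOp_empty] at hft
    exact hft ▸ zero_mem _
  | succ k ih =>
    have hg : ∀ r : {r : Submodule ℝ V // IsRational X r}, Module.finrank ℝ r.1 = n →
        ∃ U ∈ component 𝕜 X r.1 (F r.1),
          diffOp 𝕜 X (outside X r.1) U = diffOp 𝕜 X (outside X r.1) f := fun r hrn =>
      exists_mem_component_diffOp_outside_eq r.2 (hF r.1 r.2)
        (diffOp_outside_mem_dahmenMicchelli r.2 hf fun t htr ht =>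
          hzero t ht (hrn ▸ Submodule.finrank_lt_finrank_of_lt htr))
    choose! U hU hUf using hg
    let R : Finset {r : Submodule ℝ V // IsRational X r} :=
      Finset.univ.filter fun r => Module.finrank ℝ r.1 = n
    have hR : ∀ r ∈ R, Module.finrank ℝ r.1 = n := fun r hr => (Finset.mem_filter.1 hr).2
    have hsum : ∑ r ∈ R, U r ∈
        ⨆ r : {r : Submodule ℝ V // IsRational X r}, component 𝕜 X r.1 (F r.1) :=
      sum_mem fun r hr => Submodule.mem_iSup_of_mem r (hU r (hR r hr))
    rw [← sub_add_cancel f (∑ r ∈ R, U r)]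
    refine add_mem (ih (n + 1) (by omega) (sub_mem hf (sum_mem fun r hr =>
      component_le_spaceG r.2 (hF r.1 r.2) (hU r (hR r hr)))) fun t ht htn => ?_) hsum
    -- Since `dim t ≤ n = dim r`, a subspace `r ≠ t` is not contained in `t`.
    have hother : ∀ r ∈ R, r.1 ≠ t → diffOp 𝕜 X (outside X t) (U r) = 0 := fun r hr hrt =>
      diffOp_outside_eq_zero_of_mem_component r.2 (hF r.1 r.2) (fun hle => hrt
        (Submodule.eq_of_le_of_finrank_le hle (by have := hR r hr; omega))) (hU r (hR r hr))
    rw [map_sub, map_sum, sub_eq_zero]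
    by_cases htn' : Module.finrank ℝ t = n
    · rw [Finset.sum_eq_single_of_mem (⟨t, ht⟩ : {r : Submodule ℝ V // IsRational X r})
        (Finset.mem_filter.2 ⟨Finset.mem_univ _, htn'⟩)
        fun r hr hrt => hother r hr fun h => hrt (Subtype.ext h)]
      exact (hUf ⟨t, ht⟩ htn').symm
    · rw [hzero t ht (by omega), Finset.sum_eq_zero fun r hr => hother r hr ?_]
      rintro rfl
      exact htn' (hR r hr)

theorem spaceG_eq_iSup_component (hF : ∀ r, IsRational X r → IsRegularFace X r (F r)) :
    spaceG 𝕜 X =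
      ⨆ r : {r : Submodule ℝ V // IsRational X r}, component 𝕜 X r.1 (F r.1) :=
  le_antisymm
    (fun _ hf => mem_iSup_component_of_forall_finrank_lt hF (Module.finrank ℝ V + 1) 0
      (zero_add _) hf fun _ _ h => (Nat.not_lt_zero _ h).elim)
    (iSup_le fun r => component_le_spaceG r.2 (hF r.1 r.2))

theorem iSupIndep_component (hF : ∀ r, IsRational X r → IsRegularFace X r (F r)) :
    iSupIndep fun r : {r : Submodule ℝ V // IsRational X r} => component 𝕜 X r.1 (F r.1) := by
  classical
  refine iSupIndep_of_dfinsupp_lsum_injective _ ?_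
  rw [← LinearMap.ker_eq_bot, LinearMap.ker_eq_bot']
  intro U hU
  have hU' : ∑ r ∈ U.support, (U r : 𝓓'((⊤ : Opens V), 𝕜)) = 0 := by
    rw [DFinsupp.lsum_apply_apply, DFinsupp.sumAddHom_apply] at hU
    exact hU
  suffices H : ∀ n, ∀ r, Module.finrank ℝ r.1 = n → (U r : 𝓓'((⊤ : Opens V), 𝕜)) = 0 by
    ext r : 1
    exact Subtype.ext (H _ r rfl)
  intro n
  induction n using Nat.strong_induction_on with
  | _ n ih =>
    rintro r rfl
    refine eq_zero_of_mem_component (hF r.1 r.2) (U r).2 ?_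
    have hsum := congrArg (diffOp 𝕜 X (outside X r.1)) hU'
    -- Under `∂_{X∖r}` only the term of `r` survives: terms of smaller dimension vanish by
    -- induction, and any other `t ≠ r` is not contained in `r`.
    rw [map_sum, map_zero, Finset.sum_eq_single r] at hsum
    · exact hsum
    · intro t _ htr
      by_cases hlt : Module.finrank ℝ t.1 < Module.finrank ℝ r.1
      · rw [ih _ hlt t rfl, map_zero]
      · exact diffOp_outside_eq_zero_of_mem_component t.2 (hF t.1 t.2) (fun hle => htr
          (Subtype.ext (Submodule.eq_of_le_of_finrank_le hle (not_lt.1 hlt)))) (U t).2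
    · intro hr
      rw [DFinsupp.notMem_support_iff.1 hr, ZeroMemClass.coe_zero, map_zero]

end Decomposition

end SplineDecomposition

end

theorem theorem4p3 {𝕜 : Type*} [RCLike 𝕜]
    {V : Type*} [NormedAddCommGroup V] [NormedSpace ℝ V] [FiniteDimensional ℝ V]
    [MeasurableSpace V] [BorelSpace V]
    {m : ℕ} (X : Fin m → V) (hX : ∀ i, X i ≠ 0)
    (F : Submodule ℝ V → Set (Module.Dual ℝ V))
    (hF : ∀ r, SplineDecomposition.IsRational X r →
      SplineDecomposition.IsRegularFace X r (F r)) :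
    (∀ r, SplineDecomposition.IsRational X r →
      ∀ g ∈ SplineDecomposition.distributionsOn 𝕜 r,
        ∃! U : 𝓓'((⊤ : TopologicalSpace.Opens V), 𝕜), SplineDecomposition.IsConvolution
          (r : Set V) (SplineDecomposition.twistedSpline X r (F r)) g U) ∧
    iSupIndep (fun r : {r : Submodule ℝ V // SplineDecomposition.IsRational X r} =>
      SplineDecomposition.component 𝕜 X r.1 (F r.1)) ∧
    SplineDecomposition.spaceG 𝕜 X =
      ⨆ r : {r : Submodule ℝ V // SplineDecomposition.IsRational X r},
        SplineDecomposition.component 𝕜 X r.1 (F r.1) :=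
  ⟨fun r hr _ hg =>
      SplineDecomposition.existsUnique_isConvolution_twistedSpline (hF r hr) hg,
    SplineDecomposition.iSupIndep_component hF, SplineDecomposition.spaceG_eq_iSup_component hF⟩
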